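/- Theorem 2.4 (lower bound). Let $p_1,p_2,n\ge 0$ and $0\le r\le\min(p_1,p_2)$ be integers and let $\sigma\ge 0$. Let $\mathcal X:\mathbb R^{p_1\times p_2}\to\mathbb R^n$ be the random linear map $[\mathcal X(A)]_i=(\beta^{(i)})^{\top}A\,\gamma^{(i)}$, $i=1,\dots,n$, where all the entries of $\beta^{(1)},\dots,\beta^{(n)}\in\mathbb R^{p_1}$ and $\gamma^{(1)},\dots,\gamma^{(n)}\in\mathbb R^{p_2}$ are independent standard normal variables. For fixed $\mathcal X$ observe $y=\mathcal X(A)+z$ with $z_1,\dots,z_n$ i.i.d. $N(0,\sigma^2)$, and let $P_z$, $E_z$ be probability and expectation with respect to $z$ only. Below, $\inf_{\hat A}$ is over all measurable functions $\hat A=\hat A(y)$ from $\mathbb R^n$ to $\mathbb R^{p_1\times p_2}$ (which may depend on the known map $\mathcal X$), $\sup_A$ is over all $A\in\mathbb R^{p_1\times p_2}$ with $\operatorname{rank}(A)=r$, and $\|\cdot\|_F$ is the Frobenius norm. There is a universal constant $C>0$ such that, whenever $n>Cr\max(p_1,p_2)$, with probability at least $1-26/n$ over the draw of $\mathcal X$,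 both $$\inf_{\hat A}\sup_{A}P_z\Bigl(\|\hat A-A\|_F^2\ge\frac{\sigma^2r(p_1+p_2)}{32n}\Bigr)\ge 1-e^{-(p_1+p_2)r/64}$$ and $$\inf_{\hat A}\sup_{A}E_z\|\hat A-A\|_F^2\ge\frac{\sigma^2r(p_1+p_2)}{4n}.$$ If $n<r\max(p_1,p_2)$, then, for every realization of $\mathcal X$, $\inf_{\hat A}\sup_{A}E_z\|\hat A-A\|_F^2=\infty$. -/

import Mathlib

open MeasureTheory ProbabilityTheory
open scoped NNReal ENNReal Matrix

noncomputable section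

namespace RankOneProjection

variable {n p₁ p₂ : ℕ}

/-- The measurement map of rank-one projections: the `i`-th coordinate of the image of `A` is
`(β i)ᵀ A (γ i)`. -/
def ropMap (β : Fin n → Fin p₁ → ℝ) (γ : Fin n → Fin p₂ → ℝ) :
    Matrix (Fin p₁) (Fin p₂) ℝ →ₗ[ℝ] (Fin n → ℝ) where
  toFun A := fun i => β i ⬝ᵥ (A *ᵥ γ i)
  map_add' A B := by
    funext i
    simp [Matrix.add_mulVec, dotProduct_add]
  map_smul' c A := by
    funext i
    simp [Matrix.smul_mulVec, dotProduct_smul]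

/-- All the scalar entries of the vectors `β i` and `γ i`, as one family of random variables. -/
def entry {Ω : Type*} (β : Ω → Fin n → Fin p₁ → ℝ) (γ : Ω → Fin n → Fin p₂ → ℝ) :
    Fin n × (Fin p₁ ⊕ Fin p₂) → Ω → ℝ
  | (i, Sum.inl j), ω => β ω i j
  | (i, Sum.inr k), ω => γ ω i k

/-- The random linear map `X` is ROP from the distribution `D`: it is the rank-one projection map
of random vectors all of whose entries are independent with law `D`. -/
def IsROP {Ω : Type*} [MeasurableSpace Ω] (P : Measure Ω) (D : Measure ℝ)
    (X : Ω → Matrix (Fin p₁) (Fin p₂) ℝ →ₗ[ℝ] (Fin n → ℝ)) : Prop :=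
  ∃ (β : Ω → Fin n → Fin p₁ → ℝ) (γ : Ω → Fin n → Fin p₂ → ℝ),
    (∀ k, HasLaw (entry β γ k) D P) ∧ iIndepFun (entry β γ) P ∧
      ∀ ω, X ω = ropMap (β ω) (γ ω)

/-- The law of the noise vector: `n` independent `N(0, σ²)` coordinates. -/
def noiseLaw (n : ℕ) (σ : ℝ≥0) : Measure (Fin n → ℝ) :=
  Measure.pi fun _ => gaussianReal 0 (σ ^ 2)

open scoped Matrix.Norms.Frobenius in
/-- `inf` over estimators, `sup` over matrices of rank `r`, of the expected squared Frobenius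
loss, the data being `y = X A + z`. An estimator is a measurable function of the data (measurable entry by
entry); it may
depend on the known map `X`. -/
def minimaxRisk (X : Matrix (Fin p₁) (Fin p₂) ℝ →ₗ[ℝ] (Fin n → ℝ)) (σ : ℝ≥0) (r : ℕ) : ℝ≥0∞ :=
  ⨅ (est : (Fin n → ℝ) → Matrix (Fin p₁) (Fin p₂) ℝ)
      (_ : ∀ i j, Measurable fun y => est y i j),
    ⨆ (A : Matrix (Fin p₁) (Fin p₂) ℝ) (_ : A.rank = r),
      ∫⁻ z, ENNReal.ofReal (‖est (X A + z) - A‖ ^ 2) ∂(noiseLaw n σ)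

open scoped Matrix.Norms.Frobenius in
/-- `inf` over estimators, `sup` over matrices of rank `r`, of the probability that the squared
Frobenius loss is at least `t`. -/
def minimaxTail (X : Matrix (Fin p₁) (Fin p₂) ℝ →ₗ[ℝ] (Fin n → ℝ)) (σ : ℝ≥0) (r : ℕ) (t : ℝ) :
    ℝ≥0∞ :=
  ⨅ (est : (Fin n → ℝ) → Matrix (Fin p₁) (Fin p₂) ℝ)
      (_ : ∀ i j, Measurable fun y => est y i j),
    ⨆ (A : Matrix (Fin p₁) (Fin p₂) ℝ) (_ : A.rank = r),
      noiseLaw n σ {z | t ≤ ‖est (X A + z) - A‖ ^ 2}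

end RankOneProjection

end

namespace RankOneProjection

/-! The worst-case risk dominates any Bayes risk. Put a centred Gaussian prior on the `d = r * max
p₁ p₂` entries in the first `r` columns (or rows): almost every such matrix has rank `r`, so the
prior charges only admissible matrices. In orthonormal coordinates diagonalising the Gram matrix of
the restricted design, the posterior is a product of Gaussians with variances `v k` that do not
depend on the data (`prior_mul_likelihood`). Hence the posterior loss of any estimator is at least
`∑ v k`, and a Chernoff bound controls the posterior probability of a small loss
(`le_iSup_of_posterior`, `ofReal_le_pi_gaussianReal_sq_sub`).

Both bounds need only an upper bound on the total precision `∑ (v k)⁻¹`, by convexity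
(`card_div_le_sum`, `prod_sqrt_le_exp`). The total precision is the trace of the Gram matrix over
`σ²`, plus the prior precision. The trace has mean `n * d`, and Chebyshev gives at most `8/5 * n *
d` outside probability `26/n` (`exists_event_sum_sq_le`). No lower eigenvalue bound on the design is
needed.

If `n < d`, the design kills a nonzero matrix `V` on these positions. Two rank-`r` matrices
differing by a large multiple of `V` give the same data, so no estimator is near both
(`minimaxRisk_eq_top`). -/

/-! ### Bayes lower bounds in Gaussian linear models -/

/-- A product of nondegenerate Gaussian measures has the product density. -/
theorem pi_gaussianReal_eq_withDensity {ι : Type*} [Fintype ι] (m : ι → ℝ) {v : ι → ℝ≥0}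
    (hv : ∀ i, v i ≠ 0) :
    Measure.pi (fun i => gaussianReal (m i) (v i)) =
      (volume : Measure (ι → ℝ)).withDensity
        fun x => ENNReal.ofReal (∏ i, gaussianPDFReal (m i) (v i) (x i)) := by
  refine (Measure.pi_eq fun s hs => ?_)
  have hnn : ∀ x : ι → ℝ, 0 ≤ ∏ i, gaussianPDFReal (m i) (v i) (x i) := fun x =>
    Finset.prod_nonneg fun i _ => gaussianPDFReal_nonneg _ _ _
  have hint : Integrable (fun x : ι → ℝ => ∏ i, gaussianPDFReal (m i) (v i) (x i)) :=
    Integrable.fintype_prod fun i => integrable_gaussianPDFReal _ _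
  rw [withDensity_apply _ (MeasurableSet.univ_pi hs),
    ← ofReal_integral_eq_lintegral_ofReal hint.integrableOn (ae_of_all _ hnn),
    volume_pi, Measure.restrict_pi_pi,
    integral_fintype_prod_eq_prod (f := fun i x => gaussianPDFReal (m i) (v i) x),
    ENNReal.ofReal_prod_of_nonneg]
  · refine Finset.prod_congr rfl fun i _ => ?_
    rw [gaussianReal_apply_eq_integral _ (hv i)]
  · exact fun i _ => integral_nonneg fun x => gaussianPDFReal_nonneg _ _ _

theorem lintegral_pi_gaussianReal {ι : Type*} [Fintype ι] (m : ι → ℝ) {v : ι → ℝ≥0}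
    (hv : ∀ i, v i ≠ 0) {f : (ι → ℝ) → ℝ≥0∞} (hf : Measurable f) :
    ∫⁻ x, f x ∂Measure.pi (fun i => gaussianReal (m i) (v i)) =
      ∫⁻ x, ENNReal.ofReal (∏ i, gaussianPDFReal (m i) (v i) (x i)) * f x := by
  rw [pi_gaussianReal_eq_withDensity m hv, lintegral_withDensity_eq_lintegral_mul₀ _ hf.aemeasurable]
  · rfl
  · exact Measurable.aemeasurable (by
      refine ENNReal.measurable_ofReal.comp (Finset.measurable_prod _ fun i _ => ?_)
      exact (measurable_gaussianPDFReal _ _).comp (measurable_pi_apply i))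

/-- The product of a product Gaussian density. -/
theorem prod_gaussianPDFReal {ι : Type*} [Fintype ι] (m : ι → ℝ) (v : ι → ℝ≥0) (x : ι → ℝ) :
    ∏ i, gaussianPDFReal (m i) (v i) (x i) =
      (∏ i, (√(2 * Real.pi * v i))⁻¹) * Real.exp (∑ i, -(x i - m i) ^ 2 / (2 * v i)) := by
  rw [Real.exp_sum, ← Finset.prod_mul_distrib]
  rfl

/-- Expansion of the squared residual for an orthogonal design. -/
theorem sum_sub_sq_of_orthogonal {ι κ : Type*} [Fintype ι] [Fintype κ] [DecidableEq ι]
    (w : ι → κ → ℝ) (hw : ∀ k l, k ≠ l → w k ⬝ᵥ w l = 0) (a : ι → ℝ) (y : κ → ℝ) :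
    ∑ i, (y i - ∑ k, a k * w k i) ^ 2 =
      y ⬝ᵥ y - 2 * ∑ k, a k * (w k ⬝ᵥ y) + ∑ k, a k ^ 2 * (w k ⬝ᵥ w k) := by
  have h1 : ∑ i, (y i * ∑ k, a k * w k i) = ∑ k, a k * (w k ⬝ᵥ y) := by
    simp only [dotProduct, Finset.mul_sum]
    rw [Finset.sum_comm]
    exact Finset.sum_congr rfl fun k _ => Finset.sum_congr rfl fun i _ => by ring
  have h2 : ∑ i, (∑ k, a k * w k i) ^ 2 = ∑ k, a k ^ 2 * (w k ⬝ᵥ w k) := by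
    calc ∑ i, (∑ k, a k * w k i) ^ 2
        = ∑ k, ∑ l, a k * a l * (w k ⬝ᵥ w l) := by
          simp_rw [sq, Finset.sum_mul_sum, dotProduct, Finset.mul_sum]
          rw [Finset.sum_comm]
          refine Finset.sum_congr rfl fun k _ => ?_
          rw [Finset.sum_comm]
          exact Finset.sum_congr rfl fun l _ => Finset.sum_congr rfl fun i _ => by ring
      _ = ∑ k, a k ^ 2 * (w k ⬝ᵥ w k) := by
          refine Finset.sum_congr rfl fun k _ => ?_
          rw [Finset.sum_eq_single k]
          · ring
          · intro l _ hl
            rw [hw k l hl.symm, mul_zero]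
          · simp
  calc ∑ i, (y i - ∑ k, a k * w k i) ^ 2
      = ∑ i, (y i * y i - 2 * (y i * ∑ k, a k * w k i) + (∑ k, a k * w k i) ^ 2) :=
        Finset.sum_congr rfl fun i _ => by ring
    _ = _ := by
        rw [Finset.sum_add_distrib, Finset.sum_sub_distrib, ← Finset.mul_sum, h1, h2]
        rfl

/-- Bayes formula for a linear model with orthogonal design and a product Gaussian prior: prior
density times likelihood is a function of the data times the density of a product of Gaussians. -/
theorem prior_mul_likelihood {ι κ : Type*} [Fintype ι] [Fintype κ] [DecidableEq ι]
    (w : ι → κ → ℝ) (hw : ∀ k l, k ≠ l → w k ⬝ᵥ w l = 0) {s ρ : ℝ≥0} (hs : s ≠ 0) (hρ : ρ ≠ 0)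
    (v : ι → ℝ≥0) (hv : ∀ k, ((v k : ℝ))⁻¹ = (w k ⬝ᵥ w k) / s + ρ) (hv0 : ∀ k, v k ≠ 0) :
    ∃ h : (κ → ℝ) → ℝ, Measurable h ∧ (∀ y, 0 ≤ h y) ∧ ∀ (a : ι → ℝ) (y : κ → ℝ),
      (∏ k, gaussianPDFReal 0 ρ⁻¹ (a k)) *
          ∏ i, gaussianPDFReal (∑ k, a k * w k i) s (y i) =
        h y * ∏ k, gaussianPDFReal (v k * ((w k ⬝ᵥ y) / s)) (v k) (a k) := by
  have hs' : (s : ℝ) ≠ 0 := by exact_mod_cast hs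
  have hv' : ∀ k, (v k : ℝ) ≠ 0 := fun k => by exact_mod_cast hv0 k
  have hc : ∏ k, (√(2 * Real.pi * v k))⁻¹ ≠ 0 := by
    refine Finset.prod_ne_zero_iff.2 fun k _ => inv_ne_zero (Real.sqrt_ne_zero'.2 ?_)
    have : (0 : ℝ) < v k := by exact_mod_cast pos_iff_ne_zero.2 (hv0 k)
    positivity
  -- The marginal density of the data: the ratio of normalising constants times what remains in the
  -- exponent after completing the square in each `a k`. Orthogonality of `w` removes the cross
  -- terms.
  refine ⟨fun y => (∏ _k : ι, (√(2 * Real.pi * (ρ⁻¹ : ℝ≥0)))⁻¹) *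
    (∏ _i : κ, (√(2 * Real.pi * s))⁻¹) / (∏ k, (√(2 * Real.pi * v k))⁻¹) *
    Real.exp (-(y ⬝ᵥ y) / (2 * s) + ∑ k, v k * ((w k ⬝ᵥ y) / s) ^ 2 / 2), ?_, ?_, ?_⟩
  · unfold dotProduct
    fun_prop
  · intro y
    positivity
  · intro a y
    rw [prod_gaussianPDFReal, prod_gaussianPDFReal, prod_gaussianPDFReal]
    have key : (∑ k, -(a k - 0) ^ 2 / (2 * ((ρ⁻¹ : ℝ≥0) : ℝ))) +
        ∑ i, -(y i - ∑ k, a k * w k i) ^ 2 / (2 * s) =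
        (-(y ⬝ᵥ y) / (2 * s) + ∑ k, v k * ((w k ⬝ᵥ y) / s) ^ 2 / 2) +
        ∑ k, -(a k - v k * ((w k ⬝ᵥ y) / s)) ^ 2 / (2 * v k) := by
      have e1 : ∑ i, -(y i - ∑ k, a k * w k i) ^ 2 / (2 * s) =
          -(∑ i, (y i - ∑ k, a k * w k i) ^ 2) / (2 * s) := by
        rw [← Finset.sum_neg_distrib, Finset.sum_div]
      rw [e1, sum_sub_sq_of_orthogonal w hw]
      have e2 : -(y ⬝ᵥ y - 2 * ∑ k, a k * (w k ⬝ᵥ y) + ∑ k, a k ^ 2 * (w k ⬝ᵥ w k)) / (2 * s) =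
          -(y ⬝ᵥ y) / (2 * s) + ∑ k, (a k * (w k ⬝ᵥ y) / s - a k ^ 2 * (w k ⬝ᵥ w k) / (2 * s)) := by
        rw [Finset.sum_sub_distrib, ← Finset.sum_div, ← Finset.sum_div]
        field_simp
        ring
      rw [e2, add_left_comm, add_assoc, ← Finset.sum_add_distrib, ← Finset.sum_add_distrib]
      congr 1
      refine Finset.sum_congr rfl fun k _ => ?_
      have e3 : -(a k - v k * ((w k ⬝ᵥ y) / s)) ^ 2 / (2 * v k) =
          -(a k) ^ 2 / 2 * (v k : ℝ)⁻¹ + a k * (w k ⬝ᵥ y) / s - v k * ((w k ⬝ᵥ y) / s) ^ 2 / 2 := by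
        have := hv' k
        field_simp
        ring
      rw [e3, hv k]
      have : (ρ : ℝ) ≠ 0 := by exact_mod_cast hρ
      push_cast
      field_simp
      ring
    rw [mul_mul_mul_comm, ← Real.exp_add, key, Real.exp_add]
    generalize ∏ k, (√(2 * Real.pi * v k))⁻¹ = D at hc ⊢
    field_simp

/-- If the posterior expectation of `F` is at least `c` for all data, then so is the worst-case
expectation of `F`, even over a conull set of parameters. -/
theorem le_iSup_of_posterior {ι κ : Type*} [Fintype ι] [Fintype κ] [DecidableEq ι]
    (w : ι → κ → ℝ) (hw : ∀ k l, k ≠ l → w k ⬝ᵥ w l = 0) {s ρ : ℝ≥0} (hs : s ≠ 0) (hρ : ρ ≠ 0)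
    (v : ι → ℝ≥0) (hv : ∀ k, ((v k : ℝ))⁻¹ = (w k ⬝ᵥ w k) / s + ρ) (hv0 : ∀ k, v k ≠ 0)
    (F : (ι → ℝ) → (κ → ℝ) → ℝ≥0∞) (hF : Measurable (Function.uncurry F)) (c : ℝ≥0∞)
    (hc : ∀ (y : κ → ℝ) (m : ι → ℝ), c ≤ ∫⁻ a, F a y ∂Measure.pi fun k => gaussianReal (m k) (v k))
    {S : Set (ι → ℝ)} (hS : ∀ᵐ a, a ∈ S) :
    c ≤ ⨆ a ∈ S, ∫⁻ z, F a ((fun i => ∑ k, a k * w k i) + z)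
      ∂Measure.pi fun _ : κ => gaussianReal 0 s := by
  obtain ⟨h, hm, h0, hh⟩ := prior_mul_likelihood w hw hs hρ v hv hv0
  have hρ' : ∀ _ : ι, ρ⁻¹ ≠ 0 := fun _ => inv_ne_zero hρ
  set prior : Measure (ι → ℝ) := Measure.pi fun _ : ι => gaussianReal 0 ρ⁻¹ with hprior
  have hpd (f : ι → ℝ) (u : ι → ℝ≥0) : Measurable fun a : ι → ℝ =>
      ENNReal.ofReal (∏ k, gaussianPDFReal (f k) (u k) (a k)) :=
    ENNReal.measurable_ofReal.comp (Finset.measurable_prod _ fun i _ =>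
      (measurable_gaussianPDFReal _ _).comp (measurable_pi_apply i))
  have hlik : Measurable fun q : (ι → ℝ) × (κ → ℝ) =>
      ENNReal.ofReal (∏ i, gaussianPDFReal (∑ k, q.1 k * w k i) s (q.2 i)) := by
    refine ENNReal.measurable_ofReal.comp (Finset.measurable_prod _ fun i _ => ?_)
    exact measurable_uncurry_gaussianPDFReal.comp (Measurable.prodMk (by fun_prop)
      (Measurable.prodMk measurable_const (by fun_prop)))
  -- disintegration of the joint law of parameter and data
  have joint (G : (ι → ℝ) → (κ → ℝ) → ℝ≥0∞) (hG : Measurable (Function.uncurry G)) :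
      ∫⁻ a, ∫⁻ z, G a ((fun i => ∑ k, a k * w k i) + z)
        ∂(Measure.pi fun _ : κ => gaussianReal 0 s) ∂prior =
      ∫⁻ y, ENNReal.ofReal (h y) * ∫⁻ a, G a y
        ∂Measure.pi fun k => gaussianReal (v k * ((w k ⬝ᵥ y) / s)) (v k) := by
    have inner (a : ι → ℝ) : ∫⁻ z, G a ((fun i => ∑ k, a k * w k i) + z)
        ∂(Measure.pi fun _ : κ => gaussianReal 0 s) =
        ∫⁻ y, ENNReal.ofReal (∏ i, gaussianPDFReal (∑ k, a k * w k i) s (y i)) * G a y := by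
      have hGz : Measurable fun z => G a ((fun i => ∑ k, a k * w k i) + z) :=
        hG.comp (Measurable.prodMk measurable_const (measurable_const.add measurable_id))
      rw [lintegral_pi_gaussianReal _ (fun _ => hs) hGz]
      -- Pass from noise to data by translation invariance of Lebesgue measure.
      refine Eq.trans ?_ (lintegral_add_left_eq_self (fun y =>
        ENNReal.ofReal (∏ i, gaussianPDFReal (∑ k, a k * w k i) s (y i)) * G a y)
        (fun i => ∑ k, a k * w k i))
      refine lintegral_congr fun z => ?_
      have shift (i : κ) : gaussianPDFReal (∑ k, a k * w k i) s ((∑ k, a k * w k i) + z i) =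
          gaussianPDFReal 0 s (z i) := by simp [gaussianPDFReal]
      simp only [Pi.add_apply, shift]
    have hGl : Measurable fun q : (ι → ℝ) × (κ → ℝ) =>
        ENNReal.ofReal (∏ i, gaussianPDFReal (∑ k, q.1 k * w k i) s (q.2 i)) * G q.1 q.2 :=
      hlik.mul hG
    simp_rw [inner]
    rw [hprior, lintegral_pi_gaussianReal _ hρ' hGl.lintegral_prod_right']
    have hGla (a : ι → ℝ) : Measurable fun y : κ → ℝ =>
        ENNReal.ofReal (∏ i, gaussianPDFReal (∑ k, a k * w k i) s (y i)) * G a y :=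
      (hlik.comp (measurable_prodMk_left (x := a))).mul (hG.comp (measurable_prodMk_left (x := a)))
    have pull (a : ι → ℝ) := lintegral_const_mul (μ := volume)
      (ENNReal.ofReal (∏ k, gaussianPDFReal 0 ρ⁻¹ (a k))) (hGla a)
    simp only [← pull]
    rw [lintegral_lintegral_swap (((hpd _ _).comp measurable_fst).mul hGl).aemeasurable]
    · refine lintegral_congr fun y => ?_
      have hGy : Measurable fun a => G a y := hG.comp measurable_prodMk_right
      have hpG : Measurable fun a : ι → ℝ => ENNReal.ofReal
          (∏ k, gaussianPDFReal (v k * ((w k ⬝ᵥ y) / s)) (v k) (a k)) * G a y := (hpd _ _).mul hGy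
      rw [lintegral_pi_gaussianReal _ hv0 hGy, ← lintegral_const_mul _ hpG]
      refine lintegral_congr fun a => ?_
      rw [← mul_assoc, ← mul_assoc, ← ENNReal.ofReal_mul (Finset.prod_nonneg fun i _ =>
        gaussianPDFReal_nonneg _ _ _), hh a y, ENNReal.ofReal_mul (h0 y)]
  -- Total mass of the joint law, computed in both orders.
  have hone : ∫⁻ y, ENNReal.ofReal (h y) = 1 := by
    have := joint (fun _ _ => 1) measurable_const
    simpa using this.symm
  set B := ⨆ a ∈ S, ∫⁻ z, F a ((fun i => ∑ k, a k * w k i) + z)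
      ∂Measure.pi fun _ : κ => gaussianReal 0 s with hB
  have hac : ∀ᵐ a ∂prior, a ∈ S := by
    rw [hprior, pi_gaussianReal_eq_withDensity _ hρ']
    exact (withDensity_absolutelyContinuous _ _).ae_le hS
  calc c = ∫⁻ y, ENNReal.ofReal (h y) * c := by
        rw [lintegral_mul_const _ (by fun_prop), hone, one_mul]
    _ ≤ ∫⁻ y, ENNReal.ofReal (h y) * ∫⁻ a, F a y
          ∂Measure.pi fun k => gaussianReal (v k * ((w k ⬝ᵥ y) / s)) (v k) :=
        lintegral_mono fun y => by gcongr; exact hc y _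
    _ = ∫⁻ a, ∫⁻ z, F a ((fun i => ∑ k, a k * w k i) + z)
        ∂(Measure.pi fun _ : κ => gaussianReal 0 s) ∂prior := (joint F hF).symm
    _ ≤ ∫⁻ _a, B ∂prior := lintegral_mono_ae (hac.mono fun a ha =>
        le_iSup₂ (f := fun a (_ : a ∈ S) => ∫⁻ z, F a ((fun i => ∑ k, a k * w k i) + z)
      ∂Measure.pi fun _ : κ => gaussianReal 0 s) a ha)
    _ = B := by simp

/-! ### Posterior loss: variance and small-ball bounds -/

/-- The mean squared distance of a Gaussian variable to a constant is at least its variance. -/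
theorem ofReal_le_lintegral_sq_sub_gaussianReal (m u : ℝ) (v : ℝ≥0) :
    ENNReal.ofReal v ≤ ∫⁻ a, ENNReal.ofReal ((u - a) ^ 2) ∂gaussianReal m v := by
  have hL : MemLp (fun a : ℝ => u - a) 2 (gaussianReal m v) :=
    (memLp_const u).sub (memLp_id_gaussianReal' 2 (by simp))
  rw [← ofReal_integral_eq_lintegral_ofReal hL.integrable_sq (ae_of_all _ fun a => sq_nonneg _)]
  refine ENNReal.ofReal_le_ofReal ?_
  calc (v : ℝ) = Var[fun a => u - a; gaussianReal m v] := by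
        rw [variance_const_sub (X := fun a : ℝ => a) measurable_id.aestronglyMeasurable,
          variance_fun_id_gaussianReal]
    _ ≤ _ := variance_le_expectation_sq hL.1

theorem ofReal_sum_le_lintegral_sq_sub_pi {ι : Type*} [Fintype ι] (m u : ι → ℝ) (v : ι → ℝ≥0) :
    ENNReal.ofReal (∑ k, (v k : ℝ)) ≤ ∫⁻ a, ENNReal.ofReal (∑ k, (u k - a k) ^ 2)
      ∂Measure.pi fun k => gaussianReal (m k) (v k) := by
  simp_rw [ENNReal.ofReal_sum_of_nonneg fun k (_ : k ∈ Finset.univ) => sq_nonneg (_ : ℝ)]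
  rw [ENNReal.ofReal_sum_of_nonneg fun k _ => (v k).coe_nonneg,
    lintegral_finsetSum _ fun k _ => by fun_prop]
  refine Finset.sum_le_sum fun k _ => (ofReal_le_lintegral_sq_sub_gaussianReal (m k) (u k) _).trans ?_
  rw [← (measurePreserving_eval (fun k => gaussianReal (m k) (v k)) k).map_eq,
    lintegral_map (by fun_prop) (by fun_prop)]

/-- The Laplace transform of a squared Gaussian variable is largest for a centered one. -/
theorem integral_exp_neg_sq_sub_gaussianReal_le (m u : ℝ) {v : ℝ≥0} (hv : v ≠ 0) {l : ℝ}
    (hl : 0 ≤ l) :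
    ∫ a, Real.exp (-(l * (u - a) ^ 2)) ∂gaussianReal m v ≤ √(1 / (1 + 2 * l * v)) := by
  have hv' : (0 : ℝ) < v := by exact_mod_cast pos_iff_ne_zero.2 hv
  -- Completing the square: `b` and `c` are the precision parameter and centre of the tilted
  -- Gaussian. The leftover is a nonnegative multiple of `(u - m) ^ 2`, which is dropped.
  set b : ℝ := l + 1 / (2 * v) with hb
  have hb0 : 0 < b := by positivity
  set c : ℝ := (l * u + m / (2 * v)) / b with hc
  have hint : Integrable fun a : ℝ => Real.exp (-b * (a - c) ^ 2) :=
    (integrable_exp_neg_mul_sq hb0).comp_sub_right c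
  rw [integral_gaussianReal_eq_integral_smul hv]
  calc ∫ a, gaussianPDFReal m v a • Real.exp (-(l * (u - a) ^ 2))
      ≤ ∫ a, (√(2 * Real.pi * v))⁻¹ * Real.exp (-b * (a - c) ^ 2) := by
        refine integral_mono_of_nonneg (ae_of_all _ fun a => ?_) (hint.const_mul _)
          (ae_of_all _ fun a => ?_)
        · exact mul_nonneg (gaussianPDFReal_nonneg _ _ _) (Real.exp_pos _).le
        · simp only [gaussianPDFReal, smul_eq_mul, mul_assoc]
          rw [← Real.exp_add]
          gcongr
          have : l * (u - a) ^ 2 + (a - m) ^ 2 / (2 * v) - b * (a - c) ^ 2 =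
              l / (2 * v) / b * (u - m) ^ 2 := by
            rw [hc]
            field_simp
            rw [hb]
            field_simp
            ring
          have h2 : 0 ≤ l / (2 * v) / b * (u - m) ^ 2 := by positivity
          have h3 : -(a - m) ^ 2 / (2 * (v : ℝ)) = -((a - m) ^ 2 / (2 * v)) := by ring
          linarith
    _ = (√(2 * Real.pi * v))⁻¹ * √(Real.pi / b) := by
        rw [integral_const_mul, integral_sub_right_eq_self (fun a => Real.exp (-b * a ^ 2)) c,
          integral_gaussian]
    _ = √(1 / (1 + 2 * l * v)) := by
        rw [← Real.sqrt_inv, ← Real.sqrt_mul (by positivity), hb]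
        congr 1
        have := Real.pi_pos
        field_simp
        ring

/-- Chernoff bound for the probability that a Gaussian vector with independent coordinates is close
to a given point. -/
theorem ofReal_le_pi_gaussianReal_sq_sub {ι : Type*} [Fintype ι] (m u : ι → ℝ) {v : ι → ℝ≥0}
    (hv : ∀ k, v k ≠ 0) {l : ℝ} (hl : 0 ≤ l) (t : ℝ) :
    ENNReal.ofReal (1 - Real.exp (l * t) * ∏ k, √(1 / (1 + 2 * l * v k))) ≤
      (Measure.pi fun k => gaussianReal (m k) (v k)) {a | t ≤ ∑ k, (u k - a k) ^ 2} := by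
  set μ := Measure.pi fun k => gaussianReal (m k) (v k) with hμ
  have hms : MeasurableSet {a : ι → ℝ | t ≤ ∑ k, (u k - a k) ^ 2} :=
    measurableSet_le measurable_const (by fun_prop)
  set f : (ι → ℝ) → ℝ := fun a => ∏ k, Real.exp (-(l * (u k - a k) ^ 2)) with hf
  have hf' (a : ι → ℝ) : f a = Real.exp (-(l * ∑ k, (u k - a k) ^ 2)) := by
    rw [hf, Finset.mul_sum, ← Finset.sum_neg_distrib, Real.exp_sum]
  have hfint : Integrable f μ := by
    refine Integrable.of_bound (C := 1) (Measurable.aestronglyMeasurable (by fun_prop))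
      (ae_of_all _ fun a => ?_)
    rw [hf', Real.norm_eq_abs, Real.abs_exp, Real.exp_le_one_iff, neg_nonpos]
    exact mul_nonneg hl (Finset.sum_nonneg fun k _ => sq_nonneg _)
  have hI : ∫ a, f a ∂μ ≤ ∏ k, √(1 / (1 + 2 * l * v k)) := by
    rw [hf, hμ, integral_fintype_prod_eq_prod (f := fun k a => Real.exp (-(l * (u k - a) ^ 2)))]
    exact Finset.prod_le_prod (fun k _ => integral_nonneg fun a => (Real.exp_pos _).le)
      fun k _ => integral_exp_neg_sq_sub_gaussianReal_le _ _ (hv k) hl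
  have hM := mul_meas_ge_le_integral_of_nonneg
    (ae_of_all μ fun a => by rw [hf']; exact (Real.exp_pos _).le) hfint (Real.exp (-(l * t)))
  have hsub : {a : ι → ℝ | t ≤ ∑ k, (u k - a k) ^ 2}ᶜ ⊆ {a | Real.exp (-(l * t)) ≤ f a} := by
    intro a ha
    simp only [Set.mem_compl_iff, Set.mem_ofPred_eq, not_le] at ha ⊢
    rw [hf']
    gcongr
  have hcompl := probReal_compl_eq_one_sub (μ := μ) hms
  have h1 := measureReal_mono (μ := μ) hsub
  rw [ENNReal.ofReal_le_iff_le_toReal (measure_ne_top _ _)]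
  change _ ≤ μ.real _
  have h2 : μ.real {a : ι → ℝ | t ≤ ∑ k, (u k - a k) ^ 2}ᶜ ≤
      Real.exp (l * t) * ∏ k, √(1 / (1 + 2 * l * v k)) := by
    calc μ.real {a : ι → ℝ | t ≤ ∑ k, (u k - a k) ^ 2}ᶜ
        ≤ Real.exp (l * t) * (Real.exp (-(l * t)) * μ.real {a | Real.exp (-(l * t)) ≤ f a}) := by
          rw [← mul_assoc, ← Real.exp_add, add_neg_cancel, Real.exp_zero, one_mul]
          exact h1
      _ ≤ _ := by gcongr; exact hM.trans hI
  linarith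

/-- Bound for the product of Laplace transforms in terms of the total precision. -/
theorem prod_sqrt_le_exp {ι : Type*} [Fintype ι] {v : ι → ℝ} (hv : ∀ k, 0 < v k) {c : ℝ}
    (hc : 0 < c) (hsum : ∑ k, (v k)⁻¹ ≤ 2 * c * Fintype.card ι) :
    ∏ k, √(1 / (1 + 2 * c * v k)) ≤ Real.exp (-(Fintype.card ι * (Real.log 2 / 2))) := by
  have hterm (k : ι) : √(1 / (1 + 2 * c * v k)) ≤
      Real.exp (-(Real.log 2 / 2) + ((v k)⁻¹ / c - 2) / 8) := by
    rw [Real.sqrt_le_left (Real.exp_pos _).le, ← Real.exp_nat_mul]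
    have hvk := hv k
    -- The squared factor is `x / (x + 2) = (1 + (x - 2) / (x + 2)) / 2 ≤ exp ((x - 2) / 4) / 2`.
    -- The exponent is linear in the precision, and `hsum` says that `x` averages at most `2`.
    set x := (v k)⁻¹ / c with hx
    have hx0 : 0 < x := by positivity
    have e1 : 1 / (1 + 2 * c * v k) = 2⁻¹ * ((x - 2) / (x + 2) + 1) := by
      have hvx : v k = 1 / (x * c) := by rw [hx]; field_simp
      rw [hvx]
      field_simp
      ring
    have e2 : ((2 : ℕ) : ℝ) * (-(Real.log 2 / 2) + (x - 2) / 8) = -Real.log 2 + (x - 2) / 4 := by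
      push_cast
      ring
    rw [e1, e2, Real.exp_add, Real.exp_neg, Real.exp_log two_pos]
    refine mul_le_mul_of_nonneg_left ((Real.add_one_le_exp _).trans (Real.exp_le_exp.2 ?_))
      (by norm_num)
    rw [div_le_div_iff₀ (by positivity) (by norm_num)]
    nlinarith [sq_nonneg (x - 2)]
  calc ∏ k, √(1 / (1 + 2 * c * v k))
      ≤ ∏ k, Real.exp (-(Real.log 2 / 2) + ((v k)⁻¹ / c - 2) / 8) :=
        Finset.prod_le_prod (fun k _ => Real.sqrt_nonneg _) fun k _ => hterm k
    _ ≤ _ := by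
        rw [← Real.exp_sum, Real.exp_le_exp, Finset.sum_add_distrib, ← Finset.sum_div,
          Finset.sum_sub_distrib, ← Finset.sum_div]
        simp only [Finset.sum_const, Finset.card_univ, nsmul_eq_mul]
        have : (∑ k, (v k)⁻¹) / c ≤ 2 * Fintype.card ι := by
          rw [div_le_iff₀ hc]
          linarith
        linarith

/-- Harmonic-arithmetic mean inequality, in the form needed for the total posterior variance. -/
theorem card_div_le_sum {ι : Type*} [Fintype ι] {v : ι → ℝ} (hv : ∀ k, 0 < v k) {c : ℝ}
    (hc : 0 < c) (hsum : ∑ k, (v k)⁻¹ ≤ 2 * c * Fintype.card ι) :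
    Fintype.card ι / (2 * c) ≤ ∑ k, v k := by
  -- The convex function `x ↦ 1 / x` lies above its tangent at `x = 2 * c`.
  have hterm (k : ι) : 1 / c - (v k)⁻¹ / (4 * c ^ 2) ≤ v k := by
    have := hv k
    rw [← sub_nonneg]
    have e : v k - (1 / c - (v k)⁻¹ / (4 * c ^ 2)) = (2 * c * v k - 1) ^ 2 / (4 * c ^ 2 * v k) := by
      field_simp
      ring
    rw [e]
    positivity
  calc (Fintype.card ι : ℝ) / (2 * c)
      = Fintype.card ι / c - 2 * c * Fintype.card ι / (4 * c ^ 2) := by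
        field_simp
        ring
    _ ≤ Fintype.card ι / c - (∑ k, (v k)⁻¹) / (4 * c ^ 2) := by gcongr
    _ = ∑ k, (1 / c - (v k)⁻¹ / (4 * c ^ 2)) := by
        rw [Finset.sum_sub_distrib, ← Finset.sum_div, ← Finset.sum_div,
          Finset.sum_const, nsmul_eq_mul, Finset.card_univ, mul_one]
    _ ≤ _ := Finset.sum_le_sum fun k _ => hterm k

/-! ### Concentration of the energy of the design -/

/-- The fourth moment of a standard normal variable. -/
theorem integral_pow_four_gaussianReal : ∫ x, x ^ 4 ∂gaussianReal 0 1 = 3 := by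
  rw [integral_gaussianReal_eq_integral_smul one_ne_zero]
  have h1 (x : ℝ) : gaussianPDFReal 0 1 x • x ^ 4 =
      (√(2 * Real.pi))⁻¹ * (|x| ^ (4 : ℝ) * Real.exp (-(1 / 2) * |x| ^ (2 : ℝ))) := by
    have e4 : |x| ^ (4 : ℝ) = x ^ 4 := by
      rw [show (4 : ℝ) = ((4 : ℕ) : ℝ) by norm_num, Real.rpow_natCast, Even.pow_abs (by decide)]
    have e2 : |x| ^ (2 : ℝ) = x ^ 2 := by
      rw [show (2 : ℝ) = ((2 : ℕ) : ℝ) by norm_num, Real.rpow_natCast, Even.pow_abs (by decide)]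
    rw [e4, e2]
    simp only [gaussianPDFReal, NNReal.coe_one, mul_one, sub_zero, smul_eq_mul]
    rw [show -x ^ 2 / 2 = -(1 / 2) * x ^ 2 by ring]
    ring
  simp_rw [h1]
  rw [integral_const_mul, integral_comp_abs (f := fun x => x ^ (4 : ℝ) *
    Real.exp (-(1 / 2) * x ^ (2 : ℝ))), integral_rpow_mul_exp_neg_mul_rpow two_pos (by norm_num)
    (by norm_num)]
  have hG : Real.Gamma ((4 + 1) / 2) = 3 / 4 * √Real.pi := by
    rw [show ((4 : ℝ) + 1) / 2 = (1 / 2 + 1) + 1 by norm_num, Real.Gamma_add_one (by norm_num),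
      Real.Gamma_add_one (by norm_num), Real.Gamma_one_half_eq]
    ring
  have hp : ((1 : ℝ) / 2) ^ (-((4 : ℝ) + 1) / 2) = 4 * √2 := by
    rw [one_div, Real.inv_rpow two_pos.le, ← Real.rpow_neg two_pos.le,
      show -(-((4 : ℝ) + 1) / 2) = 2 + 1 / 2 by norm_num, Real.rpow_add two_pos,
      ← Real.sqrt_eq_rpow]
    norm_num
  rw [hG, hp, Real.sqrt_mul two_pos.le]
  have := Real.pi_pos
  field_simp

theorem integral_sq_gaussianReal : ∫ x, x ^ 2 ∂gaussianReal 0 1 = 1 := by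
  have h := variance_fun_id_gaussianReal (μ := 0) (v := 1)
  rw [variance_of_integral_eq_zero (by fun_prop) integral_id_gaussianReal] at h
  simpa using h

theorem integrable_pow_gaussianReal (k : ℕ) : Integrable (fun x : ℝ => x ^ k) (gaussianReal 0 1) := by
  have h := (memLp_id_gaussianReal (μ := 0) (v := 1) (k : ℝ≥0)).integrable_norm_pow'
  simp only [id_eq, ← norm_pow] at h
  exact (integrable_norm_iff (by fun_prop)).1 (by simpa using h)

/-- Moments of the square of a product of two independent standard normal variables. -/
theorem integral_sq_mul_sq {Ω : Type*} [MeasurableSpace Ω] {P : Measure Ω} {X Y : Ω → ℝ}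
    (hX : HasLaw X (gaussianReal 0 1) P) (hY : HasLaw Y (gaussianReal 0 1) P) (h : X ⟂ᵢ[P] Y) :
    P[fun ω => (X ω * Y ω) ^ 2] = 1 ∧ P[fun ω => (X ω * Y ω) ^ 4] = 9 ∧
      Integrable (fun ω => (X ω * Y ω) ^ 4) P := by
  have hmom {Z : Ω → ℝ} (hZ : HasLaw Z (gaussianReal 0 1) P) (k : ℕ) :
      ∫ ω, Z ω ^ k ∂P = ∫ x, x ^ k ∂gaussianReal 0 1 :=
    hZ.integral_comp (f := fun x => x ^ k) (by fun_prop)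
  have hint {Z : Ω → ℝ} (hZ : HasLaw Z (gaussianReal 0 1) P) (k : ℕ) :
      Integrable (fun ω => Z ω ^ k) P := by
    have := integrable_pow_gaussianReal k
    rw [← hZ.map_eq] at this
    exact this.comp_aemeasurable hZ.aemeasurable
  have hprod (k : ℕ) : ∫ ω, X ω ^ k * Y ω ^ k ∂P = (∫ ω, X ω ^ k ∂P) * ∫ ω, Y ω ^ k ∂P :=
    h.integral_fun_comp_mul_comp (f := fun x => x ^ k) (g := fun x => x ^ k)
      hX.aemeasurable hY.aemeasurable (by fun_prop) (by fun_prop)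
  simp_rw [mul_pow]
  refine ⟨?_, ?_, ?_⟩
  · rw [hprod, hmom hX, hmom hY, integral_sq_gaussianReal, one_mul]
  · rw [hprod, hmom hX, hmom hY, integral_pow_four_gaussianReal]
    norm_num
  · exact (h.comp (φ := fun x => x ^ 4) (ψ := fun x => x ^ 4) (by fun_prop)
      (by fun_prop)).integrable_mul (hint hX 4) (hint hY 4)

/-- Concentration of a sum of squares of products of independent standard normal variables. -/
theorem exists_event_sum_sq_le {Ω J ι : Type*} [MeasurableSpace Ω] [Fintype ι] [Finite J]
    {P : Measure Ω}
    [IsProbabilityMeasure P] {n : ℕ} (hn : 0 < n) {f : Fin n × J → Ω → ℝ}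
    (hlaw : ∀ k, HasLaw (f k) (gaussianReal 0 1) P) (hind : iIndepFun f P)
    (e : ι → J × J) (he : ∀ k, (e k).1 ≠ (e k).2) (hι : 0 < Fintype.card ι) :
    ∃ E : Set Ω, MeasurableSet E ∧ 1 - 26 / (n : ℝ) ≤ P.real E ∧ ∀ ω ∈ E,
      ∑ i, ∑ k, (f (i, (e k).1) ω * f (i, (e k).2) ω) ^ 2 ≤ 8 / 5 * n * Fintype.card ι := by
  classical
  have := Fintype.ofFinite J
  obtain ⟨d, hd⟩ : ∃ d : ℝ, d = Fintype.card ι := ⟨_, rfl⟩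
  have hd0 : 0 < d := by rw [hd]; exact_mod_cast hι
  simp only [← hd]
  have hn0 : (0 : ℝ) < n := by exact_mod_cast hn
  set W : Fin n → Ω → ℝ := fun i ω => ∑ k, (f (i, (e k).1) ω * f (i, (e k).2) ω) ^ 2 with hW
  have hmom (i : Fin n) (k : ι) := integral_sq_mul_sq (hlaw (i, (e k).1)) (hlaw (i, (e k).2))
    (hind.indepFun (by simpa using he k))
  have hterm (i : Fin n) (k : ι) :
      MemLp (fun ω => (f (i, (e k).1) ω * f (i, (e k).2) ω) ^ 2) 2 P := by
    rw [memLp_two_iff_integrable_sq]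
    · simp_rw [← pow_mul]
      exact (hmom i k).2.2
    · exact (((hlaw _).aemeasurable.mul (hlaw _).aemeasurable).pow_const 2).aestronglyMeasurable
  have hWL (i : Fin n) : MemLp (W i) 2 P := memLp_finsetSum _ fun k _ => hterm i k
  have hWmean (i : Fin n) : P[W i] = d := by
    simp only [hW]
    rw [integral_finsetSum _ fun k _ => (hterm i k).integrable one_le_two]
    simp_rw [(hmom i _).1]
    simp [hd]
  -- Cauchy–Schwarz, because terms with different `k` may share a factor and so be dependent; `9 = 3
  -- * 3` is the fourth moment of a product.
  have hWsq (i : Fin n) : P[W i ^ 2] ≤ 9 * d ^ 2 := by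
    calc P[W i ^ 2] ≤ ∫ ω, d * ∑ k, (f (i, (e k).1) ω * f (i, (e k).2) ω) ^ 4 ∂P := by
          refine integral_mono (hWL i).integrable_sq ((integrable_finsetSum _ fun k _ =>
            (hmom i k).2.2).const_mul _) fun ω => ?_
          have := sq_sum_le_card_mul_sum_sq (s := Finset.univ)
            (f := fun k => (f (i, (e k).1) ω * f (i, (e k).2) ω) ^ 2)
          simpa only [← pow_mul, Finset.card_univ, Pi.pow_apply, hW, ← hd, Nat.reduceMul] using this
      _ = 9 * d ^ 2 := by
          rw [integral_const_mul, integral_finsetSum _ fun k _ => (hmom i k).2.2]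
          simp_rw [(hmom i _).2.1]
          simp [← hd]
          ring
  have hWvar (i : Fin n) : Var[W i; P] ≤ 8 * d ^ 2 := by
    rw [variance_eq_sub (hWL i), hWmean]
    linarith [hWsq i]
  have hWind : Set.Pairwise (Finset.univ : Finset (Fin n)) fun i j => W i ⟂ᵢ[P] W j := by
    intro i _ j _ hij
    let S (i : Fin n) : Finset (Fin n × J) := {i} ×ˢ Finset.univ
    have hmem (i : Fin n) (a : J) : (i, a) ∈ S i := by simp [S]
    have hdisj : Disjoint (S i) (S j) := by
      rw [Finset.disjoint_left]
      rintro ⟨a, b⟩ h1 h2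
      simp only [S, Finset.mem_product, Finset.mem_singleton, Finset.mem_univ, and_true] at h1 h2
      exact hij (h1.symm.trans h2)
    let φ (i : Fin n) : (S i → ℝ) → ℝ := fun g =>
      ∑ k, (g ⟨(i, (e k).1), hmem i _⟩ * g ⟨(i, (e k).2), hmem i _⟩) ^ 2
    have hφ (i : Fin n) : Measurable (φ i) := by fun_prop
    exact (hind.indepFun_finset₀ (S i) (S j) hdisj fun k => (hlaw k).aemeasurable).comp (hφ i) (hφ j)
  set T : Ω → ℝ := ∑ i, W i with hT
  have hTL : MemLp T 2 P := memLp_finsetSum' _ fun i _ => hWL i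
  have hTmean : P[T] = n * d := by
    simp only [hT, Finset.sum_apply]
    rw [integral_finsetSum _ fun i _ => (hWL i).integrable one_le_two]
    simp [hWmean]
  have hTvar : Var[T; P] ≤ n * (8 * d ^ 2) := by
    rw [hT, IndepFun.variance_sum (fun i _ => hWL i) hWind]
    calc ∑ i, Var[W i; P] ≤ ∑ _i : Fin n, 8 * d ^ 2 := Finset.sum_le_sum fun i _ => hWvar i
      _ = _ := by simp
  -- The deviation is `8/5 - 1 = 3/5` of the mean; Chebyshev then gives `8 / (9/25) / n = 200 / (9 *
  -- n) ≤ 26 / n`.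
  have hc : 0 < 3 / 5 * n * d := by positivity
  have hcheb := meas_ge_le_variance_div_sq hTL hc
  set B : Set Ω := {ω | 3 / 5 * n * d ≤ |T ω - P[T]|} with hB
  -- The variables are only almost everywhere measurable, so `B` is enlarged to a measurable set of
  -- the same probability.
  refine ⟨(toMeasurable P B)ᶜ, (measurableSet_toMeasurable _ _).compl, ?_, ?_⟩
  · rw [probReal_compl_eq_one_sub (measurableSet_toMeasurable _ _), measureReal_def,
      measure_toMeasurable]
    have h1 : (P B).toReal ≤ Var[T; P] / (3 / 5 * n * d) ^ 2 :=
      ENNReal.toReal_le_of_le_ofReal (div_nonneg (variance_nonneg _ _) (sq_nonneg _)) hcheb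
    have h2 : Var[T; P] / (3 / 5 * n * d) ^ 2 ≤ 26 / n := by
      rw [div_le_div_iff₀ (by positivity) hn0]
      have : 0 < n * d ^ 2 * (n : ℝ) := by positivity
      nlinarith [mul_le_mul_of_nonneg_right hTvar hn0.le]
    linarith
  · intro ω hω
    have hω' : ω ∉ B := fun h => hω (subset_toMeasurable _ _ h)
    rw [hB, Set.mem_ofPred_eq, not_le, hTmean, abs_lt] at hω'
    have : T ω = ∑ i, ∑ k, (f (i, (e k).1) ω * f (i, (e k).2) ω) ^ 2 := by
      simp [hT, hW]
    rw [← this]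
    linarith [hω'.2]

/-! ### Generic rank and orthonormal coordinates -/

/-- A real symmetric matrix is diagonalised by an orthogonal matrix. -/
theorem exists_orthogonal_diagonal {ι : Type*} [Fintype ι] [DecidableEq ι] {H : Matrix ι ι ℝ}
    (hH : H.IsHermitian) :
    ∃ U : Matrix ι ι ℝ, U * Uᵀ = 1 ∧ ∃ μ : ι → ℝ, Uᵀ * H * U = Matrix.diagonal μ := by
  refine ⟨hH.eigenvectorUnitary, ?_, hH.eigenvalues, ?_⟩
  · have := Unitary.mul_star_self_of_mem hH.eigenvectorUnitary.2
    rwa [Matrix.star_eq_conjTranspose, Matrix.conjTranspose_eq_transpose_of_trivial] at this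
  · have := hH.conjStarAlgAut_star_eigenvectorUnitary
    rw [Unitary.conjStarAlgAut_star_apply] at this
    simpa [Matrix.star_eq_conjTranspose] using this

section Embedding

variable {p₁ p₂ : ℕ} {ι : Type*} [Fintype ι]

/-- The matrix with entry `a k` at position `e k`, and zero entries elsewhere. -/
def embed (e : ι → Fin p₁ × Fin p₂) (a : ι → ℝ) : Matrix (Fin p₁) (Fin p₂) ℝ :=
  ∑ k, a k • Matrix.single (e k).1 (e k).2 1

theorem embed_add (e : ι → Fin p₁ × Fin p₂) (a b : ι → ℝ) :
    embed e (a + b) = embed e a + embed e b := by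
  simp [embed, add_smul, Finset.sum_add_distrib]

theorem embed_smul (e : ι → Fin p₁ × Fin p₂) (t : ℝ) (a : ι → ℝ) :
    embed e (t • a) = t • embed e a := by
  simp only [embed, Pi.smul_apply, smul_eq_mul, mul_smul, Finset.smul_sum]

theorem map_embed {n : ℕ} (X : Matrix (Fin p₁) (Fin p₂) ℝ →ₗ[ℝ] (Fin n → ℝ))
    (e : ι → Fin p₁ × Fin p₂) (a : ι → ℝ) :
    X (embed e a) = ∑ k, a k • X (Matrix.single (e k).1 (e k).2 1) := by
  simp only [embed, map_sum, map_smul]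

theorem embed_apply {e : ι → Fin p₁ × Fin p₂} (he : Function.Injective e) (a : ι → ℝ) (k : ι) :
    embed e a (e k).1 (e k).2 = a k := by
  classical
  rw [embed, Matrix.sum_apply, Finset.sum_eq_single k]
  · simp
  · intro l _ hl
    have : ¬((e l).1 = (e k).1 ∧ (e l).2 = (e k).2) := fun h => hl (he (Prod.ext h.1 h.2))
    simp [this]
  · simp

theorem embed_swap (e : ι → Fin p₁ × Fin p₂) (a : ι → ℝ) :
    embed (Prod.swap ∘ e) a = (embed e a)ᵀ := by
  simp [embed, Matrix.transpose_sum, Matrix.transpose_single]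

/-- Matrices supported on the positions `e` generically have rank `r`: the others lie in the zero
set of a continuous function which has finitely many zeros on each line in some direction. -/
def GenericRank (e : ι → Fin p₁ × Fin p₂) (r : ℕ) : Prop :=
  ∃ (g : (ι → ℝ) → ℝ) (b : ι → ℝ), Continuous g ∧ (∀ a, g a ≠ 0 → (embed e a).rank = r) ∧
    ∀ a, {t : ℝ | g (a + t • b) = 0}.Finite

theorem GenericRank.swap {e : ι → Fin p₁ × Fin p₂} {r : ℕ} (h : GenericRank e r) :
    GenericRank (Prod.swap ∘ e) r := by
  obtain ⟨g, b, hg, hr, hf⟩ := h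
  exact ⟨g, b, hg, fun a ha => by rw [embed_swap, Matrix.rank_transpose, hr a ha], hf⟩

/-- The positions in the first `r` columns. -/
def firstColumns {r : ℕ} (h : r ≤ p₂) (k : Fin p₁ × Fin r) : Fin p₁ × Fin p₂ :=
  (k.1, Fin.castLE h k.2)

theorem firstColumns_injective {r : ℕ} (h : r ≤ p₂) :
    Function.Injective (firstColumns (p₁ := p₁) h) := by
  rintro ⟨i, k⟩ ⟨j, l⟩ hkl
  simpa [firstColumns] using hkl

/-- The function is the determinant of the top `r × r` block, whose nonvanishing forces rank `r`. In
the direction of the identity block it restricts to a characteristic polynomial, which is monic and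
so has finitely many roots. -/
theorem genericRank_firstColumns {r : ℕ} (h₁ : r ≤ p₁) (h₂ : r ≤ p₂) :
    GenericRank (firstColumns (p₁ := p₁) h₂) r := by
  have hJ {p : ℕ} (h : r ≤ p) :
      (1 : Matrix (Fin p) (Fin p) ℝ).submatrix (Fin.castLE h) id *
        ((1 : Matrix (Fin p) (Fin p) ℝ).submatrix (Fin.castLE h) id)ᵀ = 1 := by
    ext i j
    simp [Matrix.mul_apply, Matrix.one_apply]
  set J₁ : Matrix (Fin r) (Fin p₁) ℝ := (1 : Matrix (Fin p₁) (Fin p₁) ℝ).submatrix (Fin.castLE h₁) id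
    with hJ₁
  set J₂ : Matrix (Fin r) (Fin p₂) ℝ := (1 : Matrix (Fin p₂) (Fin p₂) ℝ).submatrix (Fin.castLE h₂) id
    with hJ₂
  let B (a : Fin p₁ × Fin r → ℝ) : Matrix (Fin p₁) (Fin r) ℝ := Matrix.of fun i k => a (i, k)
  have hB (a : Fin p₁ × Fin r → ℝ) : embed (firstColumns h₂) a = B a * J₂ := by
    ext i j
    simp only [embed, Matrix.sum_apply, Fintype.sum_prod_type, firstColumns, Matrix.mul_apply, B,
      hJ₂, Matrix.smul_apply, Matrix.single_apply, Matrix.submatrix_apply, Matrix.one_apply]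
    rw [Finset.sum_eq_single i]
    · simp
    · intro l _ hl
      simp [hl]
    · simp
  refine ⟨fun a => (J₁ * B a).det, fun k => J₁ᵀ k.1 k.2, ?_, fun a ha => ?_, fun a => ?_⟩
  · have : Continuous B := continuous_matrix fun i k => continuous_apply _
    fun_prop
  · rw [hB]
    refine le_antisymm ((Matrix.rank_mul_le_left _ _).trans (by simpa using (B a).rank_le_width)) ?_
    calc r = (J₁ * B a).rank := by
          rw [Matrix.rank_of_isUnit _ ((Matrix.isUnit_iff_isUnit_det _).2 (isUnit_iff_ne_zero.2 ha))]
          simp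
      _ = (J₁ * ((B a * J₂) * J₂ᵀ)).rank := by rw [Matrix.mul_assoc (B a), hJ, Matrix.mul_one]
      _ ≤ _ := (Matrix.rank_mul_le_right _ _).trans (Matrix.rank_mul_le_left _ _)
  · have hBt (t : ℝ) : B (a + t • fun k => J₁ᵀ k.1 k.2) = B a + t • J₁ᵀ := by
      ext i k
      simp [B]
    have hdet (t : ℝ) : (J₁ * B (a + t • fun k => J₁ᵀ k.1 k.2)).det =
        (-(J₁ * B a)).charpoly.eval t := by
      rw [hBt, Matrix.mul_add, Matrix.mul_smul, hJ, Matrix.eval_charpoly, sub_neg_eq_add, add_comm,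
        Matrix.scalar_apply, Matrix.smul_one_eq_diagonal]
    refine (Polynomial.finite_setOfPred_isRoot
      (Matrix.charpoly_monic (-(J₁ * B a))).ne_zero).subset fun t ht => ?_
    exact (hdet t).symm.trans ht

end Embedding

open scoped Matrix.Norms.Frobenius in
theorem frobenius_norm_sq {p₁ p₂ : ℕ} (A : Matrix (Fin p₁) (Fin p₂) ℝ) :
    ‖A‖ ^ 2 = ∑ q : Fin p₁ × Fin p₂, A q.1 q.2 ^ 2 := by
  rw [Matrix.frobenius_norm_def, ← Real.sqrt_eq_rpow, Real.sq_sqrt (by positivity),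
    Fintype.sum_prod_type]
  simp

/-- Almost every parameter in orthonormal coordinates gives a matrix of the generic rank. -/
theorem GenericRank.ae_rank {p₁ p₂ r : ℕ} {ι : Type*} [Fintype ι] [DecidableEq ι]
    {e : ι → Fin p₁ × Fin p₂}
    (h : GenericRank e r) {U : Matrix ι ι ℝ} (hU : U * Uᵀ = 1) :
    ∀ᵐ a : ι → ℝ, a ∈ {a | (embed e (U *ᵥ a)).rank = r} := by
  obtain ⟨g, b, hg, hr, hf⟩ := h
  have hcont : Continuous fun a : ι → ℝ => g (U *ᵥ a) := by fun_prop
  have hms : MeasurableSet {a : ι → ℝ | g (U *ᵥ a) ≠ 0} :=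
    (isOpen_ne_fun hcont continuous_const).measurableSet
  have key : ∀ᵐ a : ι → ℝ, a ∈ {a | g (U *ᵥ a) ≠ 0} := by
    -- Fubini along the direction `Uᵀ *ᵥ b`: each line meets the zero set in a finite set.
    refine ae_mem_of_ae_add_linearMap_mem (LinearMap.toSpanSingleton ℝ (ι → ℝ) (Uᵀ *ᵥ b)) volume
      volume hms fun a => ?_
    rw [ae_iff]
    refine Set.Finite.measure_zero ((hf (U *ᵥ a)).subset fun t ht => ?_) _
    simpa [Matrix.mulVec_add, Matrix.mulVec_smul, hU] using ht
  exact key.mono fun a ha => hr _ ha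

variable {p₁ p₂ n : ℕ}

/-- Orthonormal coordinates in which the design is orthogonal. -/
theorem exists_orthogonal_design {ι : Type*} [Fintype ι] [DecidableEq ι] (u : ι → Fin n → ℝ) :
    ∃ (U : Matrix ι ι ℝ) (w : ι → Fin n → ℝ), U * Uᵀ = 1 ∧ (∀ k l, k ≠ l → w k ⬝ᵥ w l = 0) ∧
      (∑ k, w k ⬝ᵥ w k = ∑ k, u k ⬝ᵥ u k) ∧
      ∀ a : ι → ℝ, ∑ k, (U *ᵥ a) k • u k = fun i => ∑ k, a k * w k i := by
  set M : Matrix (Fin n) ι ℝ := Matrix.of fun i k => u k i with hM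
  have hH : (Mᵀ * M).IsHermitian := by
    simpa using Matrix.isHermitian_conjTranspose_mul_self M
  obtain ⟨U, hU, μ, hμ⟩ := exists_orthogonal_diagonal hH
  have hdot (k l : ι) : (M * U)ᵀ k ⬝ᵥ (M * U)ᵀ l = (Uᵀ * (Mᵀ * M) * U) k l := by
    rw [Matrix.mul_assoc, Matrix.mul_assoc, ← Matrix.mul_assoc, ← Matrix.transpose_mul]
    rfl
  refine ⟨U, (M * U)ᵀ, hU, fun k l hkl => ?_, ?_, fun a => ?_⟩
  · rw [hdot, hμ, Matrix.diagonal_apply_ne _ hkl]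
  · simp_rw [hdot]
    calc (Uᵀ * (Mᵀ * M) * U).trace = (Mᵀ * M).trace := by
          rw [Matrix.trace_mul_comm, ← Matrix.mul_assoc, hU, Matrix.one_mul]
      _ = _ := rfl
  · have h : ∑ k, (U *ᵥ a) k • u k = M *ᵥ (U *ᵥ a) := by
      ext i
      simp [hM, Matrix.mulVec, dotProduct, mul_comm]
    rw [h, Matrix.mulVec_mulVec]
    ext i
    simp only [Matrix.mulVec, dotProduct, Matrix.transpose_apply, mul_comm]

open scoped Matrix.Norms.Frobenius in
/-- The loss dominates the loss of the coordinates. -/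
theorem sum_sq_sub_le_norm_sq {ι : Type*} [Fintype ι] [DecidableEq ι] {e : ι → Fin p₁ × Fin p₂}
    (he : Function.Injective e) {U : Matrix ι ι ℝ} (hU : U * Uᵀ = 1)
    (D : Matrix (Fin p₁) (Fin p₂) ℝ) (a : ι → ℝ) :
    ∑ k, ((Uᵀ *ᵥ fun k => D (e k).1 (e k).2) k - a k) ^ 2 ≤ ‖D - embed e (U *ᵥ a)‖ ^ 2 := by
  have hUU : Uᵀ * U = 1 := mul_eq_one_comm.1 hU
  set v : ι → ℝ := (fun k => D (e k).1 (e k).2) - U *ᵥ a with hv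
  have h1 : (Uᵀ *ᵥ fun k => D (e k).1 (e k).2) - a = Uᵀ *ᵥ v := by
    rw [hv, Matrix.mulVec_sub, Matrix.mulVec_mulVec, hUU, Matrix.one_mulVec]
  have h2 : (Uᵀ *ᵥ v) ⬝ᵥ (Uᵀ *ᵥ v) = v ⬝ᵥ v := by
    rw [Matrix.dotProduct_mulVec, Matrix.vecMul_transpose, Matrix.mulVec_mulVec, hU,
      Matrix.one_mulVec]
  calc ∑ k, ((Uᵀ *ᵥ fun k => D (e k).1 (e k).2) k - a k) ^ 2
      = (Uᵀ *ᵥ v) ⬝ᵥ (Uᵀ *ᵥ v) := by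
        rw [← h1]
        simp only [dotProduct, Pi.sub_apply, sq]
    _ = ∑ k, (D - embed e (U *ᵥ a)) (e k).1 (e k).2 ^ 2 := by
        rw [h2]
        simp only [dotProduct, hv, Pi.sub_apply, Matrix.sub_apply, embed_apply he, sq]
    _ ≤ _ := by
        rw [frobenius_norm_sq, ← Finset.sum_image (f := fun q : Fin p₁ × Fin p₂ =>
          (D - embed e (U *ᵥ a)) q.1 q.2 ^ 2) (s := Finset.univ) (g := e) he.injOn]
        exact Finset.sum_le_sum_of_subset_of_nonneg (Finset.subset_univ _)
          fun q _ _ => sq_nonneg _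

/-! ### Minimax bounds for a fixed design -/

/-- The reduction of both minimax quantities to posterior expectations: a lower bound `c` for the
posterior expectations of a function `f` of the coordinate loss is a lower bound for the worst-case
expectation of any function of the loss which dominates it. -/
theorem le_iSup_rank {ι : Type*} [Fintype ι] [DecidableEq ι]
    {e : ι → Fin p₁ × Fin p₂} (he : Function.Injective e) {r : ℕ} (hgen : GenericRank e r)
    (X : Matrix (Fin p₁) (Fin p₂) ℝ →ₗ[ℝ] (Fin n → ℝ)) {σ : ℝ≥0} (hσ : σ ≠ 0) (hn : 0 < n)
    (hX : ∑ k, X (Matrix.single (e k).1 (e k).2 1) ⬝ᵥ X (Matrix.single (e k).1 (e k).2 1) ≤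
      8 / 5 * n * Fintype.card ι)
    {f : ℝ → ℝ≥0∞} (hf : Measurable f) {c : ℝ≥0∞}
    (hc : ∀ (m u : ι → ℝ) (v : ι → ℝ≥0), (∀ k, v k ≠ 0) →
      ∑ k, ((v k : ℝ))⁻¹ ≤ 2 * (n / (σ : ℝ) ^ 2) * Fintype.card ι →
      c ≤ ∫⁻ a, f (∑ k, (u k - a k) ^ 2) ∂Measure.pi fun k => gaussianReal (m k) (v k))
    {est : (Fin n → ℝ) → Matrix (Fin p₁) (Fin p₂) ℝ}
    (hest : ∀ i j, Measurable fun y => est y i j)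
    {G : Matrix (Fin p₁) (Fin p₂) ℝ → (Fin n → ℝ) → ℝ≥0∞}
    (hG : open scoped Matrix.Norms.Frobenius in
      ∀ A z x, x ≤ ‖est (X A + z) - A‖ ^ 2 → f x ≤ G A z) :
    c ≤ ⨆ (A : Matrix (Fin p₁) (Fin p₂) ℝ) (_ : A.rank = r), ∫⁻ z, G A z ∂(noiseLaw n σ) := by
  obtain ⟨U, w, hU, hw, htr, hXw⟩ :=
    exists_orthogonal_design fun k => X (Matrix.single (e k).1 (e k).2 1)
  have hn0 : (0 : ℝ) < n := by exact_mod_cast hn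
  have hσ0 : (0 : ℝ) < σ := by exact_mod_cast pos_iff_ne_zero.2 hσ
  -- Chosen so that the average precision is at most `(8/5 + 2/5) * n / σ²`.
  set ρ : ℝ≥0 := 2 / 5 * (n / σ ^ 2) with hρ
  have hρ0 : ρ ≠ 0 := by
    rw [hρ]
    positivity
  have hww (k : ι) : 0 ≤ w k ⬝ᵥ w k := by
    simpa using dotProduct_star_self_nonneg (w k)
  set q : ι → ℝ≥0 := fun k => (w k ⬝ᵥ w k).toNNReal / σ ^ 2 + ρ with hq
  have hqc (k : ι) : (q k : ℝ) = w k ⬝ᵥ w k / ((σ ^ 2 : ℝ≥0) : ℝ) + ρ := by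
    simp [hq, Real.coe_toNNReal _ (hww k)]
  have hq0 (k : ι) : (q k)⁻¹ ≠ 0 := inv_ne_zero (by simp [hq, hρ0])
  have hqsum : ∑ k, (((q k)⁻¹ : ℝ≥0) : ℝ)⁻¹ ≤ 2 * (n / (σ : ℝ) ^ 2) * Fintype.card ι := by
    simp only [NNReal.coe_inv, inv_inv, hqc]
    rw [Finset.sum_add_distrib, ← Finset.sum_div, htr, Finset.sum_const, Finset.card_univ,
      nsmul_eq_mul, hρ]
    push_cast
    calc _ ≤ 8 / 5 * n * Fintype.card ι / (σ : ℝ) ^ 2 +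
          Fintype.card ι * (2 / 5 * (n / (σ : ℝ) ^ 2)) := by gcongr
      _ = _ := by ring
  set F : (ι → ℝ) → (Fin n → ℝ) → ℝ≥0∞ := fun a y =>
    f (∑ k, ((Uᵀ *ᵥ fun k => est y (e k).1 (e k).2) k - a k) ^ 2) with hF
  have hFm : Measurable (Function.uncurry F) := by
    refine hf.comp (Finset.measurable_sum _ fun k _ => Measurable.pow_const ?_ 2)
    refine Measurable.sub ?_ (by fun_prop)
    simp only [Matrix.mulVec, dotProduct]
    exact Finset.measurable_sum _ fun l _ =>
      measurable_const.mul ((hest (e l).1 (e l).2).comp measurable_snd)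
  refine (le_iSup_of_posterior w hw (s := σ ^ 2) (pow_ne_zero 2 hσ) hρ0 (fun k => (q k)⁻¹)
    (fun k => by rw [NNReal.coe_inv, inv_inv, hqc]) hq0 F hFm c
    (fun y m => hc m _ _ hq0 hqsum) (hgen.ae_rank hU)).trans ?_
  refine iSup₂_le fun a ha => ?_
  refine le_trans (lintegral_mono fun z => ?_)
    (le_iSup₂ (f := fun (A : Matrix (Fin p₁) (Fin p₂) ℝ) (_ : A.rank = r) =>
      ∫⁻ z, G A z ∂(noiseLaw n σ)) (embed e (U *ᵥ a)) ha)
  have hXa : X (embed e (U *ᵥ a)) = fun i => ∑ k, a k * w k i := by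
    rw [map_embed, hXw]
  refine hG _ _ _ ?_
  rw [hXa]
  exact sum_sq_sub_le_norm_sq he hU _ _

instance (σ : ℝ≥0) : IsProbabilityMeasure (noiseLaw n σ) := by
  unfold noiseLaw
  infer_instance

/-- Supplies two matrices of rank `r` with prescribed difference: on the line `t • b`, only finitely
many `t` are bad for either. -/
theorem GenericRank.exists_rank_eq {ι : Type*} [Fintype ι] {e : ι → Fin p₁ × Fin p₂} {r : ℕ}
    (h : GenericRank e r) (a : ι → ℝ) :
    ∃ b, (embed e b).rank = r ∧ (embed e (a + b)).rank = r := by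
  obtain ⟨g, b, -, hr, hf⟩ := h
  obtain ⟨t, ht⟩ := ((hf 0).union (hf a)).infinite_compl.nonempty
  simp only [Set.mem_compl_iff, Set.mem_union, not_or] at ht
  refine ⟨t • b, ?_, hr _ ht.2⟩
  have := hr _ ht.1
  rwa [zero_add] at this

/-- There are `r * max p₁ p₂` positions which support matrices of generic rank `r`. -/
theorem exists_positions {r : ℕ} (h : r ≤ min p₁ p₂) :
    ∃ e : Fin (max p₁ p₂) × Fin r → Fin p₁ × Fin p₂, Function.Injective e ∧ GenericRank e r := by
  have h₁ : r ≤ p₁ := h.trans (min_le_left _ _)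
  have h₂ : r ≤ p₂ := h.trans (min_le_right _ _)
  rcases le_total p₂ p₁ with hp | hp
  · rw [max_eq_left hp]
    exact ⟨firstColumns h₂, firstColumns_injective h₂, genericRank_firstColumns h₁ h₂⟩
  · rw [max_eq_right hp]
    exact ⟨Prod.swap ∘ firstColumns h₁, Prod.swap_injective.comp (firstColumns_injective h₁),
      (genericRank_firstColumns h₂ h₁).swap⟩

/-- Lower bound for the minimax risk for a well-behaved design. -/
theorem le_minimaxRisk {ι : Type*} [Fintype ι] [DecidableEq ι]
    {e : ι → Fin p₁ × Fin p₂} (he : Function.Injective e) {r : ℕ} (hgen : GenericRank e r)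
    (X : Matrix (Fin p₁) (Fin p₂) ℝ →ₗ[ℝ] (Fin n → ℝ)) {σ : ℝ≥0} (hσ : σ ≠ 0) (hn : 0 < n)
    (hX : ∑ k, X (Matrix.single (e k).1 (e k).2 1) ⬝ᵥ X (Matrix.single (e k).1 (e k).2 1) ≤
      8 / 5 * n * Fintype.card ι) :
    ENNReal.ofReal ((σ : ℝ) ^ 2 * Fintype.card ι / (2 * n)) ≤ minimaxRisk X σ r := by
  have hn0 : (0 : ℝ) < n := by exact_mod_cast hn
  have hσ0 : (0 : ℝ) < σ := by exact_mod_cast pos_iff_ne_zero.2 hσ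
  refine le_iInf₂ fun est hest => ?_
  refine le_iSup_rank he hgen X hσ hn hX ENNReal.measurable_ofReal (fun m u v hv hsum => ?_) hest
    fun A z x hx => ENNReal.ofReal_le_ofReal hx
  refine le_trans (ENNReal.ofReal_le_ofReal ?_) (ofReal_sum_le_lintegral_sq_sub_pi m u v)
  have := card_div_le_sum (v := fun k => (v k : ℝ))
    (fun k => by exact_mod_cast pos_iff_ne_zero.2 (hv k)) (by positivity) hsum
  refine le_trans (le_of_eq ?_) this
  field_simp

/-- Lower bound for the minimax tail probability for a well-behaved design. -/
theorem le_minimaxTail {ι : Type*} [Fintype ι] [DecidableEq ι]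
    {e : ι → Fin p₁ × Fin p₂} (he : Function.Injective e) {r : ℕ} (hgen : GenericRank e r)
    (X : Matrix (Fin p₁) (Fin p₂) ℝ →ₗ[ℝ] (Fin n → ℝ)) {σ : ℝ≥0} (hσ : σ ≠ 0) (hn : 0 < n)
    (hX : ∑ k, X (Matrix.single (e k).1 (e k).2 1) ⬝ᵥ X (Matrix.single (e k).1 (e k).2 1) ≤
      8 / 5 * n * Fintype.card ι) (t : ℝ) :
    ENNReal.ofReal (1 - Real.exp (n / (σ : ℝ) ^ 2 * t - Fintype.card ι * (Real.log 2 / 2))) ≤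
      minimaxTail X σ r t := by
  have hn0 : (0 : ℝ) < n := by exact_mod_cast hn
  have hσ0 : (0 : ℝ) < σ := by exact_mod_cast pos_iff_ne_zero.2 hσ
  have hc0 : 0 < n / (σ : ℝ) ^ 2 := by positivity
  refine le_iInf₂ fun est hest => ?_
  refine le_trans (le_iSup_rank he hgen X hσ hn hX (f := (Set.Ici t).indicator 1)
    (measurable_one.indicator measurableSet_Ici) (fun m u v hv hsum => ?_) hest
    (G := fun A => {z | open scoped Matrix.Norms.Frobenius in
      t ≤ ‖est (X A + z) - A‖ ^ 2}.indicator 1) fun A z x hx => ?_)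
    (iSup₂_mono fun A _ => lintegral_indicator_one_le _)
  · have hms : MeasurableSet {a : ι → ℝ | t ≤ ∑ k, (u k - a k) ^ 2} :=
      measurableSet_le measurable_const (by fun_prop)
    have heq (a : ι → ℝ) : (Set.Ici t).indicator (1 : ℝ → ℝ≥0∞) (∑ k, (u k - a k) ^ 2) =
        {a : ι → ℝ | t ≤ ∑ k, (u k - a k) ^ 2}.indicator 1 a := rfl
    simp_rw [heq]
    rw [lintegral_indicator_one hms]
    refine le_trans (ENNReal.ofReal_le_ofReal ?_)
      (ofReal_le_pi_gaussianReal_sq_sub m u hv hc0.le t)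
    have := prod_sqrt_le_exp (v := fun k => (v k : ℝ))
      (fun k => by exact_mod_cast pos_iff_ne_zero.2 (hv k)) hc0 hsum
    rw [sub_eq_add_neg (_ * t), Real.exp_add]
    gcongr
  · by_cases h : t ≤ x
    · rw [Set.indicator_of_mem (show x ∈ Set.Ici t from h), Set.indicator_of_mem]
      · rfl
      · exact h.trans hx
    · rw [Set.indicator_of_notMem (show x ∉ Set.Ici t from h)]
      exact zero_le

open scoped Matrix.Norms.Frobenius in
/-- With fewer measurements than free parameters, the minimax risk is infinite. -/
theorem minimaxRisk_eq_top {ι : Type*} [Fintype ι] {e : ι → Fin p₁ × Fin p₂}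
    (he : Function.Injective e) {r : ℕ} (hgen : GenericRank e r) (hn : n < Fintype.card ι)
    (X : Matrix (Fin p₁) (Fin p₂) ℝ →ₗ[ℝ] (Fin n → ℝ)) (σ : ℝ≥0) : minimaxRisk X σ r = ∞ := by
  let Le : (ι → ℝ) →ₗ[ℝ] (Fin n → ℝ) := X ∘ₗ
    { toFun := embed e, map_add' := embed_add e, map_smul' := embed_smul e }
  obtain ⟨V, hV, hV0⟩ := (Submodule.ne_bot_iff _).1
    (LinearMap.ker_ne_bot_of_finrank_lt (f := Le) (by simpa using hn))
  have hXV : X (embed e V) = 0 := hV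
  have hpos : 0 < ‖embed e V‖ := by
    obtain ⟨k, hk⟩ := Function.ne_iff.1 hV0
    refine norm_pos_iff.2 fun h => hk ?_
    rw [← embed_apply he V k, h]
    rfl
  refine eq_top_iff.2 (le_iInf₂ fun est hest => ?_)
  set B := ⨆ (A : Matrix (Fin p₁) (Fin p₂) ℝ) (_ : A.rank = r),
    ∫⁻ z, ENNReal.ofReal (‖est (X A + z) - A‖ ^ 2) ∂(noiseLaw n σ) with hB
  have hle (A : Matrix (Fin p₁) (Fin p₂) ℝ) (hA : A.rank = r) :
      ∫⁻ z, ENNReal.ofReal (‖est (X A + z) - A‖ ^ 2) ∂(noiseLaw n σ) ≤ B :=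
    le_iSup₂ (f := fun (A : Matrix (Fin p₁) (Fin p₂) ℝ) (_ : A.rank = r) =>
      ∫⁻ z, ENNReal.ofReal (‖est (X A + z) - A‖ ^ 2) ∂(noiseLaw n σ)) A hA
  have hmeas (A : Matrix (Fin p₁) (Fin p₂) ℝ) :
      Measurable fun z => ENNReal.ofReal (‖est (X A + z) - A‖ ^ 2) := by
    simp_rw [frobenius_norm_sq]
    refine ENNReal.measurable_ofReal.comp (Finset.measurable_sum _ fun q _ => ?_)
    refine Measurable.pow_const (Measurable.sub ?_ measurable_const) 2
    exact (hest q.1 q.2).comp (measurable_const.add measurable_id)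
  -- The two matrices share their data, so the triangle inequality and `(x + y)² ≤ 2 * (x² + y²)`
  -- bound their squared distance by the two losses.
  have key (s : ℝ) : ENNReal.ofReal (s ^ 2 * ‖embed e V‖ ^ 2) ≤ 2 * (B + B) := by
    obtain ⟨b, hb, hb'⟩ := hgen.exists_rank_eq (s • V)
    have hX : X (embed e (s • V + b)) = X (embed e b) := by
      rw [embed_add, embed_smul, map_add, map_smul, hXV, smul_zero, zero_add]
    calc ENNReal.ofReal (s ^ 2 * ‖embed e V‖ ^ 2)
        = ∫⁻ _z, ENNReal.ofReal (s ^ 2 * ‖embed e V‖ ^ 2) ∂(noiseLaw n σ) := by simp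
      _ ≤ ∫⁻ z, 2 * (ENNReal.ofReal (‖est (X (embed e b) + z) - embed e b‖ ^ 2) +
            ENNReal.ofReal (‖est (X (embed e (s • V + b)) + z) - embed e (s • V + b)‖ ^ 2))
            ∂(noiseLaw n σ) := by
          refine lintegral_mono fun z => ?_
          rw [← ENNReal.ofReal_add (by positivity) (by positivity),
            ← ENNReal.ofReal_ofNat 2, ← ENNReal.ofReal_mul (by norm_num), hX]
          refine ENNReal.ofReal_le_ofReal ?_
          set D := est (X (embed e b) + z)
          have h1 : s • embed e V = (D - embed e b) - (D - embed e (s • V + b)) := by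
            rw [embed_add, embed_smul]
            abel
          have h2 : |s| * ‖embed e V‖ ≤ ‖D - embed e b‖ + ‖D - embed e (s • V + b)‖ := by
            rw [← Real.norm_eq_abs, ← norm_smul, h1]
            exact norm_sub_le _ _
          have h3 := pow_le_pow_left₀ (by positivity) h2 2
          rw [mul_pow, sq_abs] at h3
          nlinarith [sq_nonneg (‖D - embed e b‖ - ‖D - embed e (s • V + b)‖)]
      _ ≤ 2 * (B + B) := by
          rw [lintegral_const_mul' _ _ (by simp), lintegral_add_left (hmeas _)]
          gcongr
          · exact hle _ hb
          · exact hle _ hb'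
  by_contra hB'
  have hBt : B ≠ ∞ := fun h => hB' (by rw [h])
  have hfin : 2 * (B + B) ≠ ∞ := ENNReal.mul_ne_top (by simp) (by simp [hBt])
  obtain ⟨s, hs⟩ := exists_nat_gt ((2 * (B + B)).toReal / ‖embed e V‖ ^ 2)
  rw [div_lt_iff₀ (by positivity)] at hs
  have h1 := (ENNReal.ofReal_le_iff_le_toReal hfin).1 (key s)
  have h2 : (s : ℝ) ≤ s ^ 2 := by exact_mod_cast Nat.le_self_pow two_ne_zero s
  nlinarith [mul_le_mul_of_nonneg_right h2 (sq_nonneg ‖embed e V‖)]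

/-! ### The random design and the theorem -/

theorem ropMap_single (β : Fin n → Fin p₁ → ℝ) (γ : Fin n → Fin p₂ → ℝ) (j : Fin p₁) (k : Fin p₂)
    (i : Fin n) : ropMap β γ (Matrix.single j k 1) i = β i j * γ i k := by
  simp [ropMap, dotProduct, Matrix.mulVec, Matrix.single_apply, ite_and]

/-- With high probability the design is well behaved on a given set of positions. -/
theorem IsROP.exists_event {Ω ι : Type*} [MeasurableSpace Ω] [Fintype ι] {P : Measure Ω}
    [IsProbabilityMeasure P] {X : Ω → Matrix (Fin p₁) (Fin p₂) ℝ →ₗ[ℝ] (Fin n → ℝ)}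
    (hX : IsROP P (gaussianReal 0 1) X) (hn : 0 < n) (e : ι → Fin p₁ × Fin p₂)
    (hι : 0 < Fintype.card ι) :
    ∃ E : Set Ω, MeasurableSet E ∧ 1 - 26 / (n : ℝ) ≤ P.real E ∧ ∀ ω ∈ E,
      ∑ k, X ω (Matrix.single (e k).1 (e k).2 1) ⬝ᵥ X ω (Matrix.single (e k).1 (e k).2 1) ≤
        8 / 5 * n * Fintype.card ι := by
  obtain ⟨β, γ, hlaw, hind, hXω⟩ := hX
  obtain ⟨E, hE, hP, hle⟩ := exists_event_sum_sq_le hn hlaw hind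
    (fun k => (Sum.inl (e k).1, Sum.inr (e k).2)) (fun k => by simp) hι
  refine ⟨E, hE, hP, fun ω hω => le_trans (le_of_eq ?_) (hle ω hω)⟩
  rw [Finset.sum_comm]
  simp only [dotProduct, hXω, ropMap_single, entry, sq]

/-- The minimax tail probability at threshold zero is one. -/
theorem one_le_minimaxTail {r : ℕ} (hr : r ≤ min p₁ p₂)
    (X : Matrix (Fin p₁) (Fin p₂) ℝ →ₗ[ℝ] (Fin n → ℝ)) (σ : ℝ≥0) : 1 ≤ minimaxTail X σ r 0 := by
  obtain ⟨e, -, hgen⟩ := exists_positions hr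
  obtain ⟨b, hb, -⟩ := hgen.exists_rank_eq 0
  refine le_iInf₂ fun est _ => ?_
  refine le_trans (le_of_eq ?_) (le_iSup₂ (embed e b) hb)
  have : {z | open scoped Matrix.Norms.Frobenius in
      0 ≤ ‖est (X (embed e b) + z) - embed e b‖ ^ 2} = Set.univ :=
    Set.eq_univ_of_forall fun z => by rw [Set.mem_ofPred_eq]; positivity
  rw [this, measure_univ]

end RankOneProjection

theorem theorem2p4 :
    ∃ C : ℝ, 0 < C ∧
      ∀ (p₁ p₂ n r : ℕ), r ≤ min p₁ p₂ →
      ∀ (σ : ℝ≥0) (Ω : Type*) [MeasurableSpace Ω] (P : Measure Ω) [IsProbabilityMeasure P]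
        (X : Ω → Matrix (Fin p₁) (Fin p₂) ℝ →ₗ[ℝ] (Fin n → ℝ)),
      RankOneProjection.IsROP P (gaussianReal 0 1) X →
        (C * r * max (p₁ : ℝ) (p₂ : ℝ) < n →
          ∃ E : Set Ω, MeasurableSet E ∧ 1 - 26 / (n : ℝ) ≤ P.real E ∧
            ∀ ω ∈ E,
              ENNReal.ofReal (1 - Real.exp (-(((p₁ : ℝ) + p₂) * r / 64))) ≤
                RankOneProjection.minimaxTail (X ω) σ r
                  ((σ : ℝ) ^ 2 * r * ((p₁ : ℝ) + p₂) / (32 * n)) ∧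
              ENNReal.ofReal ((σ : ℝ) ^ 2 * r * ((p₁ : ℝ) + p₂) / (4 * n)) ≤
                RankOneProjection.minimaxRisk (X ω) σ r) ∧
        (n < r * max p₁ p₂ →
          ∀ ω, RankOneProjection.minimaxRisk (X ω) σ r = ∞) := by
  -- Any positive constant would do: the lower bound on `n` serves only to make `n` positive.
  refine ⟨1, one_pos, fun p₁ p₂ n r hr σ Ω _ P _ X hX => ⟨fun hn => ?_, fun hn ω => ?_⟩⟩
  · have hn0 : (0 : ℝ) < n := lt_of_le_of_lt (by positivity) hn
    -- The degenerate case, where both thresholds vanish.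
    by_cases h0 : (σ : ℝ) ^ 2 * r * ((p₁ : ℝ) + p₂) = 0
    · refine ⟨Set.univ, MeasurableSet.univ, ?_, fun ω _ => ?_⟩
      · rw [probReal_univ, sub_le_self_iff]
        positivity
      · rw [h0, zero_div, zero_div, ENNReal.ofReal_zero]
        refine ⟨le_trans ?_ (RankOneProjection.one_le_minimaxTail hr _ _), zero_le⟩
        rw [← ENNReal.ofReal_one]
        exact ENNReal.ofReal_le_ofReal (sub_le_self _ (Real.exp_pos _).le)
    · obtain ⟨e, he, hgen⟩ := RankOneProjection.exists_positions hr
      have hn' : 0 < n := by exact_mod_cast hn0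
      have hσ : σ ≠ 0 := by
        rintro rfl
        simp at h0
      have hr0 : r ≠ 0 := by
        rintro rfl
        simp at h0
      have hcard : Fintype.card (Fin (max p₁ p₂) × Fin r) = max p₁ p₂ * r := by simp
      have hpos : 0 < Fintype.card (Fin (max p₁ p₂) × Fin r) := by
        rw [hcard]
        exact Nat.mul_pos (by omega) (by omega)
      obtain ⟨E, hE, hP, hdes⟩ := hX.exists_event hn' e hpos
      -- A maximum is at least the mean; this turns `d / 2` into `r * (p₁ + p₂) / 4` in the risk
      -- bound.
      have hsum : ((p₁ : ℝ) + p₂) * r ≤ 2 * Fintype.card (Fin (max p₁ p₂) × Fin r) := by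
        rw [hcard]
        have : p₁ + p₂ ≤ 2 * max p₁ p₂ := by omega
        have h' : (p₁ + p₂) * r ≤ 2 * (max p₁ p₂ * r) := by
          rw [← mul_assoc]
          exact Nat.mul_le_mul_right r this
        exact_mod_cast h'
      have hσ0 : (0 : ℝ) < σ := by exact_mod_cast pos_iff_ne_zero.2 hσ
      refine ⟨E, hE, hP, fun ω hω => ⟨?_, ?_⟩⟩
      · refine le_trans (ENNReal.ofReal_le_ofReal ?_)
          (RankOneProjection.le_minimaxTail he hgen (X ω) hσ hn' (hdes ω hω) _)
        have e1 : n / (σ : ℝ) ^ 2 * ((σ : ℝ) ^ 2 * r * ((p₁ : ℝ) + p₂) / (32 * n)) =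
            ((p₁ : ℝ) + p₂) * r / 32 := by
          field_simp
        rw [e1]
        refine sub_le_sub_left (Real.exp_le_exp.2 ?_) _
        -- With `d ≥ r * (p₁ + p₂) / 2`, the claim reduces to `log 2 / 4 - 1/32 ≥ 1/64`.
        have hlog := Real.log_two_gt_d9
        have hd0 : (0 : ℝ) ≤ Fintype.card (Fin (max p₁ p₂) × Fin r) := Nat.cast_nonneg _
        nlinarith
      · refine le_trans (ENNReal.ofReal_le_ofReal ?_)
          (RankOneProjection.le_minimaxRisk he hgen (X ω) hσ hn' (hdes ω hω))
        rw [div_le_div_iff₀ (by positivity) (by positivity)]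
        have := mul_le_mul_of_nonneg_left hsum (by positivity : 0 ≤ (σ : ℝ) ^ 2 * (2 * n))
        linarith
  · obtain ⟨e, he, hgen⟩ := RankOneProjection.exists_positions hr
    refine RankOneProjection.minimaxRisk_eq_top he hgen ?_ (X ω) σ
    simpa [mul_comm] using hn
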